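/- For a topological space $T$, let $\mathsf{RC}(T)$ be the Boolean algebra of regular closed subsets of $T$ (sets equal to the closure of their interior), with $X+Y=X\cup Y$, $X\cdot Y=\overline{(X\cap Y)^\circ}$, $-X=\overline{T\setminus X}$, $0=\emptyset$, $1=T$; and let $\mathsf{RCP}(\mathbb{R}^n)$ be the Boolean subalgebra of $\mathsf{RC}(\mathbb{R}^n)$ generated by the closed half-spaces. A $\mathcal{BC}c$-formula is a propositional combination (with $\lor,\land,\neg$) of atoms $\tau_1=\tau_2$, $C(\tau_1,\tau_2)$ and $c(\tau)$, where the terms $\tau$ are built from variables with $+,\cdot,-,0,1$. Under an assignment of regular closed sets to the variables, $C(\tau_1,\tau_2)$ says that the values of $\tau_1,\tau_2$ have non-empty intersection, and $c(\tau)$ says that the value of $\tau$ is connected (the empty set counts as connected). A formula is satisfiable over a Boolean subalgebra $\mathcal{S}$ of $\mathsf{RC}(T)$ if it is true under some assignment of elements of $\mathcal{S}$ to its variables. A space $T$ is called unicoherent if it is connected and, whenever $T=X_1\cup X_2$ with $X_1,X_2$ closed and connected, the set $X_1\cap X_2$ is connected. Let $\phi_\infty$ be the following $\mathcal{BC}c$-formula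 in the variables $r_0,\dots,r_3,r'_0,\dots,r'_3,t$, where $\lfloor k\rfloor$ denotes $k$ modulo $4$ and $\sigma\le\tau$ abbreviates $\sigma\cdot(-\tau)=0$: \begin{gather*} r_0+r_1+r_2+r_3=1\ \land\bigwedge_{0\le i<j\le 3}(r_i\cdot r_j=0)\ \land\bigwedge_{i=0}^{3}(r_i\ne 0)\ \land\ \neg C(r_0,r_2)\land\neg C(r_1,r_3)\\ \land\ \bigwedge_{i=0}^{3}\bigl((r'_i\neq 0)\land (r'_i\le r_i)\bigr)\ \land\ (t\ne 0)\ \land\ \bigwedge_{i=0}^{3}c(r'_i+r_{\lfloor i+1\rfloor}+t)\\ \land\ \bigwedge_{i=0}^{3}\neg C(r'_i,t)\ \land\ \bigwedge_{i=0}^{3}\neg C\bigl(r'_i,\ r_{\lfloor i+1\rfloor}\cdot(-r'_{\lfloor i+1\rfloor})\bigr). \end{gather*} **Theorem.** (i) $\phi_\infty$ is satisfiable over $\mathsf{RC}(\mathbb{R}^n)$ for every $n\ge 2$. (ii) If $T$ is a locally connected, unicoherent space, then every tuple from $\mathsf{RC}(T)$ satisfying $\phi_\infty$ contains a set with infinitely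 many connected components. (iii) Hence $\phi_\infty$ is not satisfiable over $\mathsf{RCP}(\mathbb{R}^n)$ for any $n\ge 1$. -/

import Mathlib

namespace BCc

/-! ### Regular closed sets -/

/-- A subset of a topological space is regular closed if it is the closure of its interior;
`RC T` is the set of all regular closed subsets of `T`. -/
def RC (T : Type*) [TopologicalSpace T] : Type _ :=
  {X : Set T // closure (interior X) = X}

namespace RC

variable {T : Type*} [TopologicalSpace T]

instance : CoeOut (RC T) (Set T) := ⟨Subtype.val⟩

instance : PartialOrder (RC T) := inferInstanceAs (PartialOrder {_X : Set T // _})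

theorem le_iff {X Y : RC T} : X ≤ Y ↔ (X : Set T) ⊆ Y := Iff.rfl

theorem isClosed (X : RC T) : IsClosed (X : Set T) := by
  rw [← X.2]; exact isClosed_closure

theorem closure_interior_closure_of_isOpen {U : Set T} (hU : IsOpen U) :
    closure (interior (closure U)) = closure U := by
  apply subset_antisymm
  · exact closure_minimal interior_subset isClosed_closure
  · exact closure_mono (interior_maximal subset_closure hU)

theorem closure_interior_union (X Y : RC T) :
    closure (interior ((X : Set T) ∪ Y)) = (X : Set T) ∪ Y := by
  apply subset_antisymm
  · exact closure_minimal interior_subset (X.isClosed.union Y.isClosed)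
  · rintro p (hp | hp)
    · rw [← X.2] at hp
      exact closure_mono (interior_mono Set.subset_union_left) hp
    · rw [← Y.2] at hp
      exact closure_mono (interior_mono Set.subset_union_right) hp

/-- The sum `X + Y`, which is the union. -/
instance : Max (RC T) := ⟨fun X Y => ⟨(X : Set T) ∪ Y, closure_interior_union X Y⟩⟩

/-- The product `X · Y`, which is the closure of the interior of the intersection. -/
instance : Min (RC T) := ⟨fun X Y =>
  ⟨closure (interior ((X : Set T) ∩ Y)), closure_interior_closure_of_isOpen isOpen_interior⟩⟩

/-- The complement `-X`, which is the closure of the set-theoretic complement. -/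
instance : Compl (RC T) := ⟨fun X =>
  ⟨closure (X : Set T)ᶜ, closure_interior_closure_of_isOpen X.isClosed.isOpen_compl⟩⟩

instance : Bot (RC T) := ⟨⟨∅, by simp⟩⟩

instance : Top (RC T) := ⟨⟨Set.univ, by simp⟩⟩

theorem coe_sup (X Y : RC T) : ((X ⊔ Y : RC T) : Set T) = (X : Set T) ∪ Y := rfl

theorem coe_inf (X Y : RC T) :
    ((X ⊓ Y : RC T) : Set T) = closure (interior ((X : Set T) ∩ Y)) := rfl

theorem coe_compl (X : RC T) : ((Xᶜ : RC T) : Set T) = closure (X : Set T)ᶜ := rfl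

theorem coe_bot : ((⊥ : RC T) : Set T) = ∅ := rfl

theorem coe_top : ((⊤ : RC T) : Set T) = Set.univ := rfl

/-- The Boolean algebra of regular closed sets. -/
instance : BooleanAlgebra (RC T) where
  sup := max
  le_sup_left _ _ := le_iff.2 Set.subset_union_left
  le_sup_right _ _ := le_iff.2 Set.subset_union_right
  sup_le _ _ _ h₁ h₂ := le_iff.2 (Set.union_subset (le_iff.1 h₁) (le_iff.1 h₂))
  inf := min
  inf_le_left X _ := le_iff.2
    (closure_minimal (interior_subset.trans Set.inter_subset_left) X.isClosed)
  inf_le_right _ Y := le_iff.2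
    (closure_minimal (interior_subset.trans Set.inter_subset_right) Y.isClosed)
  le_inf X Y Z h₁ h₂ := by
    rw [le_iff, coe_inf, ← X.2]
    exact closure_mono (interior_mono (Set.subset_inter h₁ h₂))
  le_sup_inf X Y Z := by
    rw [le_iff, coe_inf]
    refine closure_minimal ?_ (RC.isClosed _)
    intro p hp
    by_cases hX : p ∈ (X : Set T)
    · exact Or.inl hX
    · refine Or.inr (subset_closure ?_)
      rw [mem_interior]
      refine ⟨interior (((X ⊔ Y : RC T) : Set T) ∩ ((X ⊔ Z : RC T) : Set T)) ∩ (X : Set T)ᶜ, ?_,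
        isOpen_interior.inter X.isClosed.isOpen_compl, hp, hX⟩
      rintro q ⟨hq, hqX⟩
      obtain ⟨h₁, h₂⟩ := interior_subset hq
      exact ⟨h₁.resolve_left hqX, h₂.resolve_left hqX⟩
  compl := compl
  top := ⊤
  bot := ⊥
  le_top X := le_iff.2 (Set.subset_univ _)
  bot_le X := le_iff.2 (Set.empty_subset _)
  inf_compl_le_bot X := by
    rw [le_iff, coe_inf, coe_compl, coe_bot, closure_compl, interior_inter]
    have h : interior (X : Set T) ∩ interior (interior (X : Set T))ᶜ = ∅ := by
      ext p
      simp only [Set.mem_inter_iff, Set.mem_empty_iff_false, iff_false, not_and]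
      exact fun h₁ h₂ => interior_subset h₂ h₁
    rw [h, closure_empty]
  top_le_sup_compl X := by
    rw [le_iff, coe_sup, coe_compl]
    intro p _
    by_cases hp : p ∈ (X : Set T)
    · exact Or.inl hp
    · exact Or.inr (subset_closure hp)

end RC

/-! ### Unicoherence and components

As usual for these notions, the empty set counts as connected, so that connectedness is
Mathlib's `IsPreconnected`. -/

/-- A space is unicoherent if it is connected and, whenever it is the union of two closed
connected sets, their intersection is connected. -/
def Unicoherent (T : Type*) [TopologicalSpace T] : Prop :=
  PreconnectedSpace T ∧
    ∀ X₁ X₂ : Set T, IsClosed X₁ → IsClosed X₂ → IsPreconnected X₁ → IsPreconnected X₂ →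
      X₁ ∪ X₂ = Set.univ → IsPreconnected (X₁ ∩ X₂)

/-- The connected components of a subset `X` of a topological space. -/
def components {T : Type*} [TopologicalSpace T] (X : Set T) : Set (Set T) :=
  connectedComponentIn X '' X

/-! ### Polyhedra -/

/-- The half-space `{x | b ≤ ⟪a, x⟫}` with `a ≠ 0`. The other half-space bounded by the same
hyperplane is obtained from `-a` and `-b`. -/
def halfSpace {n : ℕ} (a : EuclideanSpace ℝ (Fin n)) (ha : a ≠ 0) (b : ℝ) :
    RC (EuclideanSpace ℝ (Fin n)) :=
  ⟨{x | b ≤ inner ℝ a x}, by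
    have hc : Continuous (innerSL ℝ a) := (innerSL ℝ a).continuous
    have hs : Function.Surjective (innerSL ℝ a) := by
      intro y
      refine ⟨(y / inner ℝ a a) • a, ?_⟩
      have h : inner ℝ a a ≠ 0 := inner_self_ne_zero.2 ha
      simp only [innerSL_apply_apply, inner_smul_right]
      field_simp
    have ho : IsOpenMap (innerSL ℝ a) := (innerSL ℝ a).isOpenMap hs
    change closure (interior ((innerSL ℝ a) ⁻¹' Set.Ici b)) = (innerSL ℝ a) ⁻¹' Set.Ici b
    rw [← ho.preimage_interior_eq_interior_preimage hc, interior_Ici,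
      ← ho.preimage_closure_eq_closure_preimage hc, closure_Ioi]⟩

/-- `RCP n` is the Boolean subalgebra of `RC (ℝⁿ)` generated by the half-spaces. -/
def RCP (n : ℕ) : BooleanSubalgebra (RC (EuclideanSpace ℝ (Fin n))) :=
  BooleanSubalgebra.closure {H | ∃ (a : EuclideanSpace ℝ (Fin n)) (ha : a ≠ 0) (b : ℝ),
    H = halfSpace a ha b}

/-! ### The language with Boolean operations, contact and connectedness -/

/-- Boolean terms over a countably infinite supply of variables. -/
inductive Term : Type
  | var : ℕ → Term
  | add : Term → Term → Term
  | mul : Term → Term → Term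
  | compl : Term → Term
  | zero : Term
  | one : Term

/-- Formulas: equalities `τ₁ = τ₂`, contact `C(τ₁, τ₂)`, connectedness `c(τ)`, and their
propositional combinations. -/
inductive Formula : Type
  | eq : Term → Term → Formula
  | contact : Term → Term → Formula
  | conn : Term → Formula
  | or : Formula → Formula → Formula
  | and : Formula → Formula → Formula
  | not : Formula → Formula

/-- The variables occurring in a term. -/
def Term.vars : Term → Finset ℕ
  | .var v => {v}
  | .add s t => s.vars ∪ t.vars
  | .mul s t => s.vars ∪ t.vars
  | .compl s => s.vars
  | .zero => ∅
  | .one => ∅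

/-- The variables occurring in a formula. -/
def Formula.vars : Formula → Finset ℕ
  | .eq s t => s.vars ∪ t.vars
  | .contact s t => s.vars ∪ t.vars
  | .conn s => s.vars
  | .or φ ψ => φ.vars ∪ ψ.vars
  | .and φ ψ => φ.vars ∪ ψ.vars
  | .not φ => φ.vars

section Semantics

variable {T : Type*} [TopologicalSpace T]

/-- The value of a term under an assignment of regular closed sets to the variables. -/
def Term.eval (I : ℕ → RC T) : Term → RC T
  | .var v => I v
  | .add s t => s.eval I ⊔ t.eval I
  | .mul s t => s.eval I ⊓ t.eval I
  | .compl s => (s.eval I)ᶜ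
  | .zero => ⊥
  | .one => ⊤

/-- Truth of a formula under an assignment of regular closed sets to the variables. -/
def Formula.Holds (I : ℕ → RC T) : Formula → Prop
  | .eq s t => s.eval I = t.eval I
  | .contact s t => ((s.eval I : Set T) ∩ (t.eval I : Set T)).Nonempty
  | .conn s => IsPreconnected (s.eval I : Set T)
  | .or φ ψ => φ.Holds I ∨ ψ.Holds I
  | .and φ ψ => φ.Holds I ∧ ψ.Holds I
  | .not φ => ¬ φ.Holds I

/-- A formula is satisfiable over the frame given by a Boolean subalgebra `S` of `RC T` if it
is true under some assignment of elements of `S` to the variables. -/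
def SatisfiableOver (S : BooleanSubalgebra (RC T)) (φ : Formula) : Prop :=
  ∃ I : ℕ → RC T, (∀ v, I v ∈ S) ∧ φ.Holds I

end Semantics

/-! ### The formula `φ_∞` -/

/-- Finite conjunctions; the empty conjunction is `0 = 0`. -/
def Formula.conj : List Formula → Formula
  | [] => .eq .zero .zero
  | [φ] => φ
  | φ :: ψ :: l => .and φ (Formula.conj (ψ :: l))

/-- Finite sums; the empty sum is `0`. -/
def Term.sum : List Term → Term
  | [] => .zero
  | [s] => s
  | s :: t :: l => .add s (Term.sum (t :: l))

/-- `s ≠ t`. -/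
def Formula.ne (s t : Term) : Formula := .not (.eq s t)

/-- `s ≤ t`, that is, `s · (-t) = 0`. -/
def Formula.le (s t : Term) : Formula := .eq (.mul s (.compl t)) .zero

/-- The pairs `(i, j)` with `i < j < k`. -/
def pairs (k : ℕ) : List (ℕ × ℕ) :=
  (List.range k ×ˢ List.range k).filter fun p => p.1 < p.2

/-- `part(r₀, …, r_{k-1})`: the `rᵢ` sum to `1`, and distinct ones have product `0`. -/
def part (k : ℕ) (r : ℕ → Term) : Formula :=
  .and (.eq (Term.sum ((List.range k).map r)) .one)
    (Formula.conj ((pairs k).map fun p => .eq (.mul (r p.1) (r p.2)) .zero))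

/-- `sc-part(r₀, …, r_{k-1})`: a partition into non-empty regions such that `rᵢ` and `rⱼ` are
not in contact whenever `1 < j - i < k - 1`. -/
def scPart (k : ℕ) (r : ℕ → Term) : Formula :=
  .and (part k r)
    (.and (Formula.conj ((List.range k).map fun i => Formula.ne (r i) .zero))
      (Formula.conj (((pairs k).filter fun p => 1 < p.2 - p.1 ∧ p.2 - p.1 < k - 1).map
        fun p => .not (.contact (r p.1) (r p.2)))))

/-- The variables `r₀, …, r₃`; indices are taken modulo `4`. -/
def r (i : ℕ) : Term := .var (i % 4)

/-- The variables `r'₀, …, r'₃`; indices are taken modulo `4`. -/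
def r' (i : ℕ) : Term := .var (4 + i % 4)

/-- The variable `t`. -/
def t : Term := .var 8

/-- The conjunction of `φ 0, φ 1, φ 2, φ 3`. -/
def conj4 (φ : ℕ → Formula) : Formula := Formula.conj ((List.range 4).map φ)

/-- The formula `φ_∞`. -/
def phiInfty : Formula := Formula.conj
  [ scPart 4 r,
    conj4 fun i => .and (Formula.ne (r' i) .zero) (Formula.le (r' i) (r i)),
    Formula.ne t .zero,
    conj4 fun i => .conn (.add (.add (r' i) (r (i + 1))) t),
    conj4 fun i => .not (.contact (r' i) t),
    conj4 fun i => .not (.contact (r' i) (.mul (r (i + 1)) (.compl (r' (i + 1))))) ]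

end BCc

/-! For (ii), suppose that each `r i` has only finitely many components. Let `C` be a component of
`r i` meeting `r' i`. Connectedness of `r' i + r (i+1) + t` forces the part of `r' i` in `C` to
touch the rest of that set. The rest of `r' i` lies in the other components, which form a closed set
by finiteness, and `t` is out of reach, so the touching point lies in `r (i+1)`, and the last
conjunct places it in `r' (i+1)`. Iterating gives an endless chain of components `X k` of `r (k mod
4)`, consecutive ones sharing a point. By finiteness the chain returns to some `X a`. Delete `X a`:
the chain between the two visits lies in one component `A` of the remainder, and `A` touches `X a`
both through `r (l+1)`, on leaving, and through `r (l+3)`, on returning, where `l = a mod 4`.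
Unicoherence makes `A ∩ X a` connected, yet it is covered by these two disjoint closed sets
(`exists_components_infinite`).

For (iii), Euclidean space is unicoherent because it is simply connected
(`unicoherent_of_simplyConnectedSpace`), and polyhedra are finite unions of convex sets, so they
have finitely many components.

For (i), cut the plane into vertical unit strips labelled modulo 4, let `t` be a lower half-plane
and `r' i` the parts of the strips above a sawtooth; then pull back along a linear surjection onto
the plane. -/

namespace BCc

/-! ### Components of closed sets with finitely many components -/

section Components

variable {T : Type*} [TopologicalSpace T]

theorem components_sUnion_finite {𝒞 : Set (Set T)} (hfin : 𝒞.Finite)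
    (hconn : ∀ C ∈ 𝒞, IsPreconnected C) : (components (⋃₀ 𝒞)).Finite := by
  -- For nonempty `C` this union is the single component containing `C`; it avoids choosing a point.
  refine (hfin.image fun C => ⋃ x ∈ C, connectedComponentIn (⋃₀ 𝒞) x).subset ?_
  rintro _ ⟨x, ⟨C, hC, hx⟩, rfl⟩
  refine ⟨C, hC, subset_antisymm (Set.iUnion₂_subset fun y hy => ?_)
    (Set.subset_biUnion_of_mem (u := fun x => connectedComponentIn (⋃₀ 𝒞) x) hx)⟩
  rw [connectedComponentIn_eq
    ((hconn C hC).subset_connectedComponentIn hx (Set.subset_sUnion_of_mem hC) hy)]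

theorem isPreconnected_of_mem_components {X C : Set T} (hC : C ∈ components X) :
    IsPreconnected C := by
  obtain ⟨x, -, rfl⟩ := hC
  exact isPreconnected_connectedComponentIn

theorem sUnion_components (X : Set T) : ⋃₀ components X = X := by
  refine subset_antisymm ?_ fun x hx => ⟨_, ⟨x, hx, rfl⟩, mem_connectedComponentIn hx⟩
  rintro y ⟨_, ⟨x, -, rfl⟩, hy⟩
  exact connectedComponentIn_subset _ _ hy

theorem isClosed_connectedComponentIn {X : Set T} (hX : IsClosed X) (x : T) :
    IsClosed (connectedComponentIn X x) := by
  by_cases hx : x ∈ X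
  · refine isClosed_of_closure_subset ?_
    exact isPreconnected_connectedComponentIn.closure.subset_connectedComponentIn
      (subset_closure (mem_connectedComponentIn hx))
      (closure_minimal (connectedComponentIn_subset _ _) hX)
  · rw [connectedComponentIn_eq_empty hx]
    exact isClosed_empty

theorem sUnion_components_diff (X : Set T) (x : T) :
    ⋃₀ (components X \ {connectedComponentIn X x}) = X \ connectedComponentIn X x := by
  ext y
  constructor
  · rintro ⟨_, ⟨⟨z, hz, rfl⟩, hne⟩, hy⟩
    refine ⟨connectedComponentIn_subset _ _ hy, fun hyx => hne ?_⟩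
    rw [Set.mem_singleton_iff, connectedComponentIn_eq hy, connectedComponentIn_eq hyx]
  · rintro ⟨hy, hyx⟩
    refine ⟨_, ⟨⟨y, hy, rfl⟩, fun h => hyx ?_⟩, mem_connectedComponentIn hy⟩
    rw [← Set.mem_singleton_iff.1 h]
    exact mem_connectedComponentIn hy

/-- A finite union of closed components is closed. All uses of finiteness in separating a component
from the others pass through here. -/
theorem isClosed_diff_connectedComponentIn {X : Set T} (hX : IsClosed X)
    (hfin : (components X).Finite) (x : T) : IsClosed (X \ connectedComponentIn X x) := by
  rw [← sUnion_components_diff]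
  rw [Set.sUnion_eq_biUnion]
  refine (hfin.subset Set.sdiff_subset).isClosed_biUnion ?_
  rintro _ ⟨⟨y, -, rfl⟩, -⟩
  exact isClosed_connectedComponentIn hX y

/-- If a connected space is the union of disjoint pieces attached to a connected set, then
discarding a piece leaves a connected set. -/
theorem isPreconnected_of_union_eq_univ [PreconnectedSpace T] {X A B : Set T}
    (hA : IsClosed A) (hB : IsClosed B) (hX : IsPreconnected X) (hXne : X.Nonempty)
    (hXB : X ⊆ B) (hAB : A ∩ B ⊆ X) (huniv : A ∪ B = Set.univ) : IsPreconnected B := by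
  -- The part of `B` on the side away from `X` is disjoint from `A`, hence clopen in the whole
  -- space.
  have key : ∀ u v : Set T, IsClosed u → IsClosed v → B ⊆ u ∪ v → (B ∩ v).Nonempty →
      ¬ (B ∩ (u ∩ v)).Nonempty → X ⊆ u → False := by
    intro u v hu hv hBuv hBv hne hXu
    have hcompl : (B ∩ v)ᶜ = A ∪ B ∩ u := by
      ext p
      constructor
      · intro hp
        rcases (huniv ▸ Set.mem_univ p : p ∈ A ∪ B) with h | h
        · exact Or.inl h
        · exact Or.inr ⟨h, (hBuv h).resolve_right fun hpv => hp ⟨h, hpv⟩⟩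
      · rintro (h | ⟨hpB, hpu⟩) ⟨hB', hv'⟩
        · exact hne ⟨p, hB', hXu (hAB ⟨h, hB'⟩), hv'⟩
        · exact hne ⟨p, hB', hpu, hv'⟩
    have hclopen : IsClopen (B ∩ v) := by
      refine ⟨hB.inter hv, ?_⟩
      rw [← isClosed_compl_iff, hcompl]
      exact hA.union (hB.inter hu)
    obtain ⟨x, hx⟩ := hXne
    have hx' : x ∈ B ∩ v := by
      rw [hclopen.eq_univ hBv]
      trivial
    exact hne ⟨x, hx'.1, hXu hx, hx'.2⟩
  rw [isPreconnected_closed_iff]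
  intro u v hu hv hBuv hBu hBv
  by_contra hne
  rcases isPreconnected_iff_subset_of_disjoint_closed.1 hX u v hu hv (hXB.trans hBuv)
    (Set.not_nonempty_iff_eq_empty.1 fun ⟨x, hx, hx'⟩ => hne ⟨x, hXB hx, hx'⟩) with h | h
  · exact key u v hu hv hBuv hBv hne h
  · exact key v u hv hu (by rwa [Set.union_comm]) hBu (by rwa [Set.inter_comm v u]) h

end Components

/-! ### A returning chain of components contradicts unicoherence -/

/-- The set-theoretic content of `φ_∞`: no such configuration has finitely many components. -/
theorem exists_components_infinite {T : Type*} [TopologicalSpace T] (hT : Unicoherent T)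
    {R R' : ZMod 4 → Set T} {t : Set T} (hR : ∀ i, IsClosed (R i)) (hR' : ∀ i, IsClosed (R' i))
    (ht : IsClosed t) (hcover : ⋃ i, R i = Set.univ) (hdisj : ∀ i, Disjoint (R i) (R (i + 2)))
    (hsub : ∀ i, R' i ⊆ R i) (hne : (R' 0).Nonempty) (htne : t.Nonempty)
    (hconn : ∀ i, IsPreconnected (R' i ∪ R (i + 1) ∪ t)) (hR't : ∀ i, Disjoint (R' i) t)
    (hshield : ∀ i, R' i ∩ R (i + 1) ⊆ R' (i + 1)) : ∃ i, (components (R i)).Infinite := by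
  by_contra hinf
  simp only [not_exists, Set.not_infinite] at hinf
  have := hT.1
  -- One link of the chain: `R' i ∩ C` must touch the rest of the connected set, and only `R (i +
  -- 1)` is available.
  have step : ∀ i, ∀ p ∈ R' i, ∃ q ∈ R' (i + 1), q ∈ connectedComponentIn (R i) p := by
    intro i p hp
    set C := connectedComponentIn (R i) p
    have hCcl : IsClosed C := isClosed_connectedComponentIn (hR i) p
    have hpC : p ∈ C := mem_connectedComponentIn (hsub i hp)
    obtain ⟨q, hq⟩ := htne
    have hqR' : q ∉ R' i := fun h => (hR't i).le_bot ⟨h, hq⟩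
    obtain ⟨x, -, hxC, hxD⟩ := isPreconnected_closed_iff.1 (hconn i) (R' i ∩ C)
      (R' i ∩ (R i \ C) ∪ R (i + 1) ∪ t) ((hR' i).inter hCcl)
      ((((hR' i).inter (isClosed_diff_connectedComponentIn (hR i) (hinf i) p)).union
        (hR (i + 1))).union ht)
      (by
        rintro x ((hx | hx) | hx)
        · by_cases hxC : x ∈ C
          · exact Or.inl ⟨hx, hxC⟩
          · exact Or.inr (Or.inl (Or.inl ⟨hx, hsub i hx, hxC⟩))
        · exact Or.inr (Or.inl (Or.inr hx))
        · exact Or.inr (Or.inr hx))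
      ⟨p, Or.inl (Or.inl hp), hp, hpC⟩ ⟨q, Or.inr hq, Or.inr hq⟩
    rcases hxD with (hx | hx) | hx
    · exact absurd hxC.2 hx.2.2
    · exact ⟨x, hshield i ⟨hxC.1, hx⟩, hxC.2⟩
    · exact absurd ⟨hxC.1, hx⟩ fun h => (hR't i).le_bot h
  choose! next hnext hnextC using step
  obtain ⟨p₀, hp₀⟩ := hne
  let p : ℕ → T := fun k => Nat.rec p₀ (fun k x => next (k : ZMod 4) x) k
  have hp : ∀ k : ℕ, p k ∈ R' (k : ZMod 4) := by
    intro k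
    induction k with
    | zero => rwa [Nat.cast_zero]
    | succ k ih =>
      rw [Nat.cast_succ]
      exact hnext _ _ ih
  let X : ℕ → Set T := fun k => connectedComponentIn (R (k : ZMod 4)) (p k)
  have hpX : ∀ k, p k ∈ X k := fun k => mem_connectedComponentIn (hsub _ (hp k))
  have hpX' : ∀ k, p (k + 1) ∈ X k := fun k => hnextC _ _ (hp k)
  have hXR : ∀ k, X k ⊆ R (k : ZMod 4) := fun k => connectedComponentIn_subset _ _
  -- Pigeonhole on pairs of a label and a component, so that the period is also divisible by 4.
  have hrep : ∃ d : ℕ, 0 < d ∧ (d : ZMod 4) = 0 ∧ ∃ a : ℕ, X (a + d) = X a := by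
    have hfin : (⋃ i, (fun C => (i, C)) '' components (R i)).Finite :=
      Set.finite_iUnion fun i => (hinf i).image _
    obtain ⟨a, -, b, -, hab, h⟩ := (Set.infinite_univ (α := ℕ)).exists_lt_map_eq_of_mapsTo
      (t := ⋃ i, (fun C => (i, C)) '' components (R i)) (f := fun k : ℕ => ((k : ZMod 4), X k))
      (fun k _ => Set.mem_iUnion.2 ⟨(k : ZMod 4), X k, ⟨p k, hsub _ (hp k), rfl⟩, rfl⟩) hfin
    obtain ⟨h₁, h₂⟩ := Prod.mk.inj h
    refine ⟨b - a, Nat.sub_pos_of_lt hab, ?_, a, ?_⟩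
    · rw [Nat.cast_sub hab.le, h₁, sub_self]
    · rw [Nat.add_sub_cancel' hab.le, h₂]
  classical
  -- The least period over all starting points: `X a` does not recur, under its own label, before
  -- step `d`.
  obtain ⟨hd0, hd4, a, ha⟩ := Nat.find_spec hrep
  set d := Nat.find hrep
  have hmin : ∀ j, 0 < j → j < d → (j : ZMod 4) = 0 → X (a + j) ≠ X a := fun j h₁ h₂ h₃ h₄ =>
    Nat.find_min hrep h₂ ⟨h₁, h₃, a, h₄⟩
  -- `a + m` is the last index before the return; its label is `l + 3`.
  have hd3 : ∃ m, d = m + 1 ∧ 0 < m ∧ (m : ZMod 4) = 3 := by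
    obtain ⟨c, hc⟩ := (ZMod.natCast_eq_zero_iff d 4).1 hd4
    refine ⟨d - 1, by omega, by omega, ?_⟩
    rw [Nat.cast_sub (by omega), hd4]
    decide
  obtain ⟨m, hdm, hm0, hm3⟩ := hd3
  set l : ZMod 4 := (a : ZMod 4)
  have hcases : ∀ i : ZMod 4, i = l ∨ i = l + 1 ∨ i = l + 2 ∨ i = l + 3 := by
    generalize l = l
    revert l
    decide
  set K : Set T := ⋃₀ ((components (R (l + 1)) ∪ components (R (l + 2)) ∪ components (R (l + 3)))
    ∪ (components (R l) \ {X a})) with hK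
  have hKeq : K = R (l + 1) ∪ R (l + 2) ∪ R (l + 3) ∪ (R l \ X a) := by
    rw [hK, Set.sUnion_union, Set.sUnion_union, Set.sUnion_union, sUnion_components,
      sUnion_components, sUnion_components, sUnion_components_diff]
  have hKfin : (components K).Finite := by
    refine components_sUnion_finite ((((hinf _).union (hinf _)).union (hinf _)).union
      ((hinf _).subset Set.sdiff_subset)) ?_
    rintro C (((hC | hC) | hC) | hC)
    exacts [isPreconnected_of_mem_components hC, isPreconnected_of_mem_components hC,
      isPreconnected_of_mem_components hC, isPreconnected_of_mem_components hC.1]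
  have hKcl : IsClosed K := by
    rw [hKeq]
    exact (((hR _).union (hR _)).union (hR _)).union
      (isClosed_diff_connectedComponentIn (hR l) (hinf l) _)
  have hRK : ∀ i, i ≠ l → R i ⊆ K := by
    intro i hi x hx
    rw [hKeq]
    rcases hcases i with h | h | h | h
    · exact absurd h hi
    all_goals subst h
    · exact Or.inl (Or.inl (Or.inl hx))
    · exact Or.inl (Or.inl (Or.inr hx))
    · exact Or.inl (Or.inr hx)
  have hl1 : l + 1 ≠ l := by generalize l = l; revert l; decide
  set A := connectedComponentIn K (p (a + 1))
  have hpR : p (a + 1) ∈ R (l + 1) := by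
    have := hsub _ (hp (a + 1))
    rwa [Nat.cast_succ] at this
  have hXK : ∀ j, 0 < j → j < d → X (a + j) ⊆ K := by
    intro j hj hjd
    by_cases hj4 : (j : ZMod 4) = 0
    · have hlab : ((a + j : ℕ) : ZMod 4) = l := by rw [Nat.cast_add, hj4, add_zero]
      have hneX := hmin j hj hjd hj4
      intro x hx
      rw [hKeq]
      refine Or.inr ⟨hlab ▸ hXR _ hx, fun hxa => hneX ?_⟩
      change connectedComponentIn (R ((a + j : ℕ) : ZMod 4)) (p (a + j)) =
        connectedComponentIn (R l) (p a)
      rw [connectedComponentIn_eq hx, hlab, connectedComponentIn_eq hxa]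
    · refine (hXR _).trans (hRK _ ?_)
      rw [Nat.cast_add]
      simpa [l] using hj4
  -- Consecutive components share a point, so `A` absorbs them one after another.
  have hXA : ∀ j, 0 < j → j < d → X (a + j) ⊆ A := by
    intro j hj
    induction j, hj using Nat.le_induction with
    | base =>
      intro h
      exact isPreconnected_connectedComponentIn.subset_connectedComponentIn (hpX _)
        (hXK 1 one_pos h)
    | succ j hj ih =>
      intro h
      have hmem : p (a + (j + 1)) ∈ A := ih (by omega) (hpX' (a + j))
      have hA : A = connectedComponentIn K (p (a + (j + 1))) := connectedComponentIn_eq hmem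
      rw [hA]
      exact isPreconnected_connectedComponentIn.subset_connectedComponentIn (hpX _)
        (hXK (j + 1) (by omega) h)
  -- `A` and `B` cover the space and overlap only inside `X a`, as unicoherence requires.
  set B := X a ∪ (K \ A)
  have hAcl : IsClosed A := isClosed_connectedComponentIn hKcl _
  have hXcl : IsClosed (X a) := isClosed_connectedComponentIn (hR _) _
  have hBcl : IsClosed B := hXcl.union (isClosed_diff_connectedComponentIn hKcl hKfin _)
  have hAB : A ∩ B = A ∩ X a := by
    ext x
    constructor
    · rintro ⟨hxA, hx | hx⟩
      · exact ⟨hxA, hx⟩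
      · exact absurd hxA hx.2
    · exact fun h => ⟨h.1, Or.inl h.2⟩
  have hABuniv : A ∪ B = Set.univ := by
    refine Set.eq_univ_of_forall fun x => ?_
    by_cases hxX : x ∈ X a
    · exact Or.inr (Or.inl hxX)
    have hxK : x ∈ K := by
      obtain ⟨i, hi⟩ := Set.mem_iUnion.1 (hcover ▸ Set.mem_univ x : x ∈ ⋃ i, R i)
      by_cases hil : i = l
      · rw [hKeq]
        exact Or.inr ⟨hil ▸ hi, hxX⟩
      · exact hRK i hil hi
    by_cases hxA : x ∈ A
    · exact Or.inl hxA
    · exact Or.inr (Or.inr ⟨hxK, hxA⟩)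
  have hBconn : IsPreconnected B :=
    isPreconnected_of_union_eq_univ hAcl hBcl isPreconnected_connectedComponentIn ⟨_, hpX a⟩
      Set.subset_union_left (hAB.trans_subset Set.inter_subset_right) hABuniv
  have hABconn := hT.2 A B hAcl hBcl isPreconnected_connectedComponentIn hBconn hABuniv
  rw [hAB] at hABconn
  -- The returning point lies in `X (a + m)` and in `X (a + d) = X a`.
  have hlast : p (a + d) ∈ R (l + 3) := by
    have h := hXR _ (hpX' (a + m))
    rwa [Nat.cast_add, hm3, add_assoc, ← hdm] at h
  obtain ⟨x, -, hx₁, hx₃⟩ := isPreconnected_closed_iff.1 hABconn (R (l + 1)) (R (l + 3))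
    (hR _) (hR _)
    (by
      rintro x ⟨hxA, hxX⟩
      have hxK := connectedComponentIn_subset _ _ hxA
      rw [hKeq] at hxK
      rcases hxK with ((h | h) | h) | h
      · exact Or.inl h
      · exact ((hdisj l).le_bot ⟨hXR _ hxX, h⟩).elim
      · exact Or.inr h
      · exact absurd hxX h.2)
    ⟨p (a + 1), ⟨mem_connectedComponentIn (hRK _ hl1 hpR), hpX' a⟩, hpR⟩
    ⟨p (a + d), ⟨hXA m hm0 (by omega) (by rw [hdm]; exact hpX' (a + m)), ha ▸ hpX (a + d)⟩, hlast⟩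
  refine (hdisj (l + 1)).le_bot ⟨hx₁, ?_⟩
  have h13 : l + 1 + 2 = l + 3 := by generalize l = l; revert l; decide
  rwa [h13]

/-! ### Unicoherence by lifting to the covering of the circle -/

section Unicoherence

variable {T : Type*} [TopologicalSpace T]

/-- The difference divided by `2π` is continuous and integer-valued on a connected set, hence
constant. -/
theorem exists_int_forall_eq_add {X : Set T} (hX : IsPreconnected X) {g h : T → ℝ}
    (hg : Continuous g) (hh : Continuous h) (hgh : ∀ x ∈ X, Circle.exp (g x) = Circle.exp (h x)) :
    ∃ m : ℤ, ∀ x ∈ X, g x = h x + m * (2 * Real.pi) := by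
  rcases X.eq_empty_or_nonempty with rfl | ⟨x₀, hx₀⟩
  · exact ⟨0, by simp⟩
  have hpi : (2 * Real.pi) ≠ 0 := by positivity
  have : IsDiscrete (Set.range ((↑) : ℤ → ℝ)) :=
    ⟨Int.isClosedEmbedding_coe_real.toIsEmbedding.toHomeomorph.symm.isEmbedding.discreteTopology⟩
  have hmaps : Set.MapsTo (fun x => (g x - h x) / (2 * Real.pi)) X
      (Set.range ((↑) : ℤ → ℝ)) := by
    intro x hx
    obtain ⟨m, hm⟩ := Circle.exp_eq_exp.1 (hgh x hx)
    exact ⟨m, by dsimp only; rw [hm]; field_simp; ring⟩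
  obtain ⟨m, hm⟩ := hmaps hx₀
  refine ⟨m, fun x hx => ?_⟩
  have := hX.constant_of_mapsTo this (by fun_prop) hmaps hx hx₀
  dsimp only at hm
  rw [← hm] at this
  field_simp at this
  linarith

/-- If `A ∩ B` split, a circle-valued map could make half a turn across `A` and the opposite half
turn across `B`. Such a map has no lift to the line, whereas simple connectedness provides one. -/
theorem unicoherent_of_simplyConnectedSpace [NormalSpace T] [SimplyConnectedSpace T]
    [LocallyPathConnectedSpace T] : Unicoherent T := by
  refine ⟨inferInstance, fun A B hA hB hAc hBc huniv => ?_⟩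
  rw [isPreconnected_closed_iff]
  rintro u v hu hv huv ⟨c, hcAB, hcu⟩ ⟨d, hdAB, hdv⟩
  by_contra hne
  have hdisj : Disjoint (A ∩ B ∩ u) (A ∩ B ∩ v) := by
    rw [Set.disjoint_left]
    exact fun x hx hx' => hne ⟨x, hx.1, hx.2, hx'.2⟩
  obtain ⟨w, hw0, hw1, -⟩ := exists_continuous_zero_one_of_isClosed
    ((hA.inter hB).inter hu) ((hA.inter hB).inter hv) hdisj
  have hw : Continuous w := w.continuous
  classical
  -- On `A ∩ B` the function `w` is 0 or 1, where the two formulas agree.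
  let f : T → Circle := fun x =>
    if x ∈ A then Circle.exp (Real.pi * w x) else Circle.exp (-(Real.pi * w x))
  have hfA : ∀ x ∈ A, f x = Circle.exp (Real.pi * w x) := fun x hx => if_pos hx
  have hfB : ∀ x ∈ B, f x = Circle.exp (-(Real.pi * w x)) := by
    intro x hx
    by_cases hxA : x ∈ A
    · rw [hfA x hxA]
      rcases huv ⟨hxA, hx⟩ with h | h
      · simp [hw0 ⟨⟨hxA, hx⟩, h⟩]
      · rw [hw1 ⟨⟨hxA, hx⟩, h⟩, Circle.exp_eq_exp]
        exact ⟨1, by simp; ring⟩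
    · exact if_neg hxA
  have hf : Continuous f := by
    rw [← continuousOn_univ, ← huniv]
    refine ContinuousOn.union_of_isClosed ?_ ?_ hA hB
    · exact ContinuousOn.congr (by fun_prop) hfA
    · exact ContinuousOn.congr (by fun_prop) hfB
  obtain ⟨e₀, he₀⟩ : ∃ e₀ : ℝ, Circle.exp e₀ = f c :=
    ⟨_, Circle.exp_arg (f c)⟩
  obtain ⟨g, ⟨-, hg⟩, -⟩ :=
    Circle.isCoveringMap_exp.existsUnique_continuousMap_lifts ⟨f, hf⟩ c e₀ he₀
  have hg' : ∀ x, Circle.exp (g x) = f x := fun x => congrFun hg x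
  obtain ⟨k, hk⟩ := exists_int_forall_eq_add hAc g.continuous (h := fun x => Real.pi * w x)
    (by fun_prop) fun x hx => (hg' x).trans (hfA x hx)
  obtain ⟨l, hl⟩ := exists_int_forall_eq_add hBc g.continuous (h := fun x => -(Real.pi * w x))
    (by fun_prop) fun x hx => (hg' x).trans (hfB x hx)
  -- At `c` the two expressions for `g` give `k = l`; at `d` they give `l = k + 1`.
  have hc₁ := hk c hcAB.1
  have hc₂ := hl c hcAB.2
  have hd₁ := hk d hdAB.1
  have hd₂ := hl d hdAB.2
  simp only [hw0 ⟨hcAB, hcu⟩, hw1 ⟨hdAB, hdv⟩, Pi.zero_apply, Pi.one_apply, mul_zero, mul_one,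
    neg_zero] at hc₁ hc₂ hd₁ hd₂
  have hpi := Real.pi_pos
  nlinarith

end Unicoherence

theorem unicoherent_euclideanSpace (n : ℕ) : Unicoherent (EuclideanSpace ℝ (Fin n)) :=
  unicoherent_of_simplyConnectedSpace

/-! ### Polyhedra as finite sums of convex sets -/

section FiniteConvexSums

variable {E : Type*} [NormedAddCommGroup E] [NormedSpace ℝ E]

/-- A regular closed set which is a finite sum of convex regular closed sets. -/
def RC.IsFiniteConvexSum (X : RC E) : Prop :=
  ∃ s : Finset (RC E), (∀ C ∈ s, Convex ℝ (C : Set E)) ∧ X = s.sup id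

namespace RC.IsFiniteConvexSum

theorem of_convex {X : RC E} (hX : Convex ℝ (X : Set E)) : X.IsFiniteConvexSum :=
  ⟨{X}, by simpa using hX, by simp⟩

theorem bot : (⊥ : RC E).IsFiniteConvexSum := of_convex convex_empty

theorem top : (⊤ : RC E).IsFiniteConvexSum := of_convex convex_univ

theorem sup {X Y : RC E} (hX : X.IsFiniteConvexSum) (hY : Y.IsFiniteConvexSum) :
    (X ⊔ Y).IsFiniteConvexSum := by
  classical
  obtain ⟨s, hs, rfl⟩ := hX
  obtain ⟨s', hs', rfl⟩ := hY
  refine ⟨s ∪ s', fun C hC => ?_, Finset.sup_union.symm⟩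
  exact (Finset.mem_union.1 hC).elim (hs C) (hs' C)

/-- Products distribute over finite sums, and interior and closure preserve convexity. -/
theorem inf {X Y : RC E} (hX : X.IsFiniteConvexSum) (hY : Y.IsFiniteConvexSum) :
    (X ⊓ Y).IsFiniteConvexSum := by
  classical
  obtain ⟨s, hs, rfl⟩ := hX
  obtain ⟨s', hs', rfl⟩ := hY
  refine ⟨(s ×ˢ s').image fun p => p.1 ⊓ p.2, fun C hC => ?_, ?_⟩
  · obtain ⟨p, hp, rfl⟩ := Finset.mem_image.1 hC
    obtain ⟨h, h'⟩ := Finset.mem_product.1 hp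
    exact ((hs _ h).inter (hs' _ h')).interior.closure
  · rw [Finset.sup_inf_sup, Finset.sup_image]
    rfl

theorem components_finite {X : RC E} (hX : X.IsFiniteConvexSum) :
    (components (X : Set E)).Finite := by
  classical
  obtain ⟨s, hs, rfl⟩ := hX
  have hcoe : ((s.sup id : RC E) : Set E) = ⋃₀ ((fun C : RC E => (C : Set E)) '' s) := by
    rw [Set.sUnion_image]
    clear hs
    induction s using Finset.induction_on with
    | empty => simp [RC.coe_bot]
    | insert C s _ ih =>
      rw [Finset.sup_insert, RC.coe_sup, ih, Finset.coe_insert, Set.biUnion_insert]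
      rfl
  rw [hcoe]
  refine components_sUnion_finite (s.finite_toSet.image _) ?_
  rintro _ ⟨C, hC, rfl⟩
  exact (hs C hC).isPreconnected

end RC.IsFiniteConvexSum

theorem convex_halfSpace {n : ℕ} (a : EuclideanSpace ℝ (Fin n)) (ha : a ≠ 0) (b : ℝ) :
    Convex ℝ (halfSpace a ha b : Set (EuclideanSpace ℝ (Fin n))) :=
  convex_halfSpace_ge (innerSL ℝ a).isLinear b

theorem convex_compl_halfSpace {n : ℕ} (a : EuclideanSpace ℝ (Fin n)) (ha : a ≠ 0) (b : ℝ) :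
    Convex ℝ (((halfSpace a ha b)ᶜ : RC _) : Set (EuclideanSpace ℝ (Fin n))) := by
  have h : ((halfSpace a ha b : Set (EuclideanSpace ℝ (Fin n))))ᶜ = {x | innerSL ℝ a x < b} := by
    ext x
    exact not_le (a := b) (b := inner ℝ a x)
  rw [RC.coe_compl, h]
  exact (convex_halfSpace_lt (innerSL ℝ a).isLinear b).closure

/-- Carrying the complement through the induction makes the complement step a swap and the sum step
De Morgan's law. -/
theorem isFiniteConvexSum_of_mem_RCP {n : ℕ} {X : RC (EuclideanSpace ℝ (Fin n))}
    (hX : X ∈ RCP n) : X.IsFiniteConvexSum ∧ Xᶜ.IsFiniteConvexSum := by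
  induction hX using BooleanSubalgebra.closure_bot_sup_induction with
  | mem x hx =>
    obtain ⟨a, ha, b, rfl⟩ := hx
    exact ⟨.of_convex (convex_halfSpace a ha b), .of_convex (convex_compl_halfSpace a ha b)⟩
  | bot => exact ⟨.bot, by rw [compl_bot]; exact .top⟩
  | sup x hx y hy ihx ihy => exact ⟨ihx.1.sup ihy.1, by rw [compl_sup]; exact ihx.2.inf ihy.2⟩
  | compl x hx ih => exact ⟨ih.2, by rw [compl_compl]; exact ih.1⟩

end FiniteConvexSums

/-! ### The meaning of the formula -/

section Unfolding

variable {T : Type*} [TopologicalSpace T]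

theorem forall_zmod_four {P : ZMod 4 → Prop} : (∀ i, P i) ↔ P 0 ∧ P 1 ∧ P 2 ∧ P 3 := by
  refine ⟨fun h => ⟨h 0, h 1, h 2, h 3⟩, fun ⟨h₀, h₁, h₂, h₃⟩ i => ?_⟩
  fin_cases i
  exacts [h₀, h₁, h₂, h₃]

/-- Variables 0 to 3 are the `r i`, 4 to 7 the `r' i`, and 8 is `t`. -/
theorem phiInfty_holds_iff {I : ℕ → RC T} : phiInfty.Holds I ↔
    I 0 ⊔ (I 1 ⊔ (I 2 ⊔ I 3)) = ⊤ ∧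
    (I 0 ⊓ I 1 = ⊥ ∧ I 0 ⊓ I 2 = ⊥ ∧ I 0 ⊓ I 3 = ⊥ ∧ I 1 ⊓ I 2 = ⊥ ∧ I 1 ⊓ I 3 = ⊥ ∧
      I 2 ⊓ I 3 = ⊥) ∧
    (I 0 ≠ ⊥ ∧ I 1 ≠ ⊥ ∧ I 2 ≠ ⊥ ∧ I 3 ≠ ⊥) ∧
    (Disjoint (I 0 : Set T) (I 2) ∧ Disjoint (I 1 : Set T) (I 3)) ∧
    ((I 4 ≠ ⊥ ∧ I 4 ≤ I 0) ∧ (I 5 ≠ ⊥ ∧ I 5 ≤ I 1) ∧ (I 6 ≠ ⊥ ∧ I 6 ≤ I 2) ∧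
      (I 7 ≠ ⊥ ∧ I 7 ≤ I 3)) ∧
    I 8 ≠ ⊥ ∧
    (IsPreconnected (I 4 ∪ I 1 ∪ I 8 : Set T) ∧ IsPreconnected (I 5 ∪ I 2 ∪ I 8 : Set T) ∧
      IsPreconnected (I 6 ∪ I 3 ∪ I 8 : Set T) ∧ IsPreconnected (I 7 ∪ I 0 ∪ I 8 : Set T)) ∧
    (Disjoint (I 4 : Set T) (I 8) ∧ Disjoint (I 5 : Set T) (I 8) ∧ Disjoint (I 6 : Set T) (I 8) ∧
      Disjoint (I 7 : Set T) (I 8)) ∧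
    (Disjoint (I 4 : Set T) (I 1 \ I 5 : RC T) ∧ Disjoint (I 5 : Set T) (I 2 \ I 6 : RC T) ∧
      Disjoint (I 6 : Set T) (I 3 \ I 7 : RC T) ∧ Disjoint (I 7 : Set T) (I 0 \ I 4 : RC T)) := by
  have h4 : pairs 4 = [(0, 1), (0, 2), (0, 3), (1, 2), (1, 3), (2, 3)] := rfl
  simp [phiInfty, scPart, part, conj4, h4, Formula.conj, Term.sum, Formula.ne, Formula.le, r, r', t,
    List.range_succ, Formula.Holds, Term.eval, ← sdiff_eq, RC.coe_sup,
    Set.disjoint_iff_inter_eq_empty, ← Set.not_nonempty_iff_eq_empty]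
  tauto

theorem exists_components_infinite_of_holds (hT : Unicoherent T) {I : ℕ → RC T}
    (h : phiInfty.Holds I) : ∃ v ∈ phiInfty.vars, (components (I v : Set T)).Infinite := by
  obtain ⟨hsum, -, -, ⟨h02, h13⟩, hR', ht, hconn, hR't, hshield⟩ := phiInfty_holds_iff.1 h
  have hnonempty : ∀ {X : RC T}, X ≠ ⊥ → (X : Set T).Nonempty := fun hX =>
    Set.nonempty_iff_ne_empty.2 fun hX' => hX (Subtype.ext hX')
  -- A point of `Y` outside `Z` lies in `Y \ Z`, since `Y ≤ Y \ Z ⊔ Z`.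
  have hsh : ∀ {X Y Z : RC T}, Disjoint (X : Set T) (Y \ Z : RC T) →
      (X : Set T) ∩ Y ⊆ Z := by
    rintro X Y Z hd x ⟨hx, hxY⟩
    have hY : x ∈ ((Y \ Z ⊔ Z : RC T) : Set T) := by
      have hle : Y ≤ Y \ Z ⊔ Z := by simp
      exact hle hxY
    exact hY.resolve_left fun hx' => hd.le_bot ⟨hx, hx'⟩
  obtain ⟨i, hi⟩ := exists_components_infinite hT (R := fun i => I i.val)
    (R' := fun i => I (4 + i.val)) (t := I 8) (fun i => RC.isClosed _) (fun i => RC.isClosed _)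
    (RC.isClosed _)
    (by
      refine Set.eq_univ_of_forall fun x => ?_
      have hx : x ∈ ((I 0 ⊔ (I 1 ⊔ (I 2 ⊔ I 3)) : RC T) : Set T) := by rw [hsum]; trivial
      rcases hx with hx | hx | hx | hx
      exacts [Set.mem_iUnion.2 ⟨0, hx⟩, Set.mem_iUnion.2 ⟨1, hx⟩, Set.mem_iUnion.2 ⟨2, hx⟩,
        Set.mem_iUnion.2 ⟨3, hx⟩])
    (forall_zmod_four.2 ⟨h02, h13, h02.symm, h13.symm⟩)
    (forall_zmod_four.2 ⟨hR'.1.2, hR'.2.1.2, hR'.2.2.1.2, hR'.2.2.2.2⟩)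
    (hnonempty hR'.1.1) (hnonempty ht) (forall_zmod_four.2 hconn) (forall_zmod_four.2 hR't)
    (forall_zmod_four.2 ⟨hsh hshield.1, hsh hshield.2.1, hsh hshield.2.2.1, hsh hshield.2.2.2⟩)
  refine ⟨i.val, ?_, hi⟩
  have hvars : ∀ i : ZMod 4, i.val ∈ phiInfty.vars := by decide
  exact hvars i

end Unfolding

/-! ### Periodic families of planar pieces -/

section Strips

variable {E : Type*} [NormedAddCommGroup E] [NormedSpace ℝ E] (f : E →L[ℝ] ℝ × ℝ)

/-- The points lying in a horizontal translate of `A` by an integer congruent to `i` mod `4`. -/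
def translates (i : ZMod 4) (A : Set (ℝ × ℝ)) : Set E :=
  {x | ∃ k : ℤ, (k : ZMod 4) = i ∧ f x - ((k : ℝ), 0) ∈ A}

/-- Confinement to unit strips makes the translates locally finite, so their union is closed. Each
translate pulls back to a regular closed set, because the affine map is open and `A` is a closed
convex set with interior. -/
theorem closure_interior_translates [CompleteSpace E] (hf : Function.Surjective f) (i : ZMod 4)
    {A : Set (ℝ × ℝ)} (hA : IsClosed A) (hconv : Convex ℝ A) (hint : (interior A).Nonempty)
    (hstrip : ∀ p ∈ A, p.1 ∈ Set.Icc (0 : ℝ) 1) :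
    closure (interior (translates f i A)) = translates f i A := by
  set g : ℤ → E → ℝ × ℝ := fun k x => f x - ((k : ℝ), 0) with hg
  have hgc : ∀ k, Continuous (g k) := fun k => by fun_prop
  have hgo : ∀ k, IsOpenMap (g k) := fun k =>
    (Homeomorph.subRight ((k : ℝ), (0 : ℝ))).isOpenMap.comp (f.isOpenMap hf)
  have hunion : translates f i A = ⋃ k : {k : ℤ // (k : ZMod 4) = i}, g k ⁻¹' A := by
    ext x
    simp [translates, hg]
  have hlf : LocallyFinite fun k : ℤ => Set.Icc (k : ℝ) (k + 1) :=
    locallyFinite_Icc_of_tendsto tendsto_intCast_atTop_atTop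
      (Filter.tendsto_atBot_add_const_right _ _ (tendsto_intCast_atBot_iff.2 Filter.tendsto_id))
  have hlf' : LocallyFinite fun k : ℤ => g k ⁻¹' A := by
    refine (hlf.preimage_continuous (g := fun x => (f x).1) (by fun_prop)).subset ?_
    intro k x hx
    have h := hstrip _ hx
    simp only [hg, Prod.fst_sub, Set.mem_Icc] at h
    constructor <;> linarith
  have hclosed : IsClosed (translates f i A) := by
    rw [hunion]
    exact (hlf'.comp_injective Subtype.val_injective).isClosed_iUnion
      fun k => hA.preimage (hgc k)
  refine subset_antisymm (closure_minimal interior_subset hclosed) ?_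
  intro x hx
  rw [hunion, Set.mem_iUnion] at hx
  obtain ⟨k, hx⟩ := hx
  have hpre : g k ⁻¹' A = closure (interior (g k ⁻¹' A)) := by
    rw [← (hgo k).preimage_interior_eq_interior_preimage (hgc k),
      ← (hgo k).preimage_closure_eq_closure_preimage (hgc k),
      hconv.closure_interior_eq_closure_of_nonempty_interior hint, hA.closure_eq]
  rw [hpre] at hx
  refine closure_mono (interior_mono ?_) hx
  rw [hunion]
  exact Set.subset_iUnion (fun k : {k : ℤ // (k : ZMod 4) = i} => g k ⁻¹' A) k

end Strips

/-! ### The strip model -/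

section Strips

/-- The vertical strip over the unit interval. -/
def unitStrip : Set (ℝ × ℝ) := {p | p.1 ∈ Set.Icc (0 : ℝ) 1}

/-- The part of the unit strip above a line of slope `1`. -/
def upperStrip : Set (ℝ × ℝ) := {p | p.1 ∈ Set.Icc (0 : ℝ) 1 ∧ 1 + p.1 ≤ p.2}

/-- The part of the unit strip below the line bounding `upperStrip`. -/
def lowerStrip : Set (ℝ × ℝ) := {p | p.1 ∈ Set.Icc (0 : ℝ) 1 ∧ p.2 ≤ 1 + p.1}

theorem isClosed_unitStrip : IsClosed unitStrip := isClosed_Icc.preimage continuous_fst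

theorem isClosed_upperStrip : IsClosed upperStrip :=
  isClosed_unitStrip.inter (isClosed_le (f := fun p : ℝ × ℝ => 1 + p.1) (g := fun p => p.2)
    (by fun_prop) (by fun_prop))

theorem isClosed_lowerStrip : IsClosed lowerStrip :=
  isClosed_unitStrip.inter (isClosed_le (f := fun p : ℝ × ℝ => p.2) (g := fun p => 1 + p.1)
    (by fun_prop) (by fun_prop))

theorem convex_unitStrip : Convex ℝ unitStrip :=
  (convex_Icc 0 1).linear_preimage (LinearMap.fst ℝ ℝ ℝ)

theorem convex_upperStrip : Convex ℝ upperStrip := by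
  have h : upperStrip = unitStrip ∩ {p | 1 ≤ (LinearMap.snd ℝ ℝ ℝ - LinearMap.fst ℝ ℝ ℝ) p} := by
    ext p
    simp [upperStrip, unitStrip, le_sub_iff_add_le]
  rw [h]
  exact convex_unitStrip.inter (convex_halfSpace_ge (LinearMap.isLinear _) 1)

theorem convex_lowerStrip : Convex ℝ lowerStrip := by
  have h : lowerStrip = unitStrip ∩ {p | (LinearMap.snd ℝ ℝ ℝ - LinearMap.fst ℝ ℝ ℝ) p ≤ 1} := by
    ext p
    simp [lowerStrip, unitStrip]
  rw [h]
  exact convex_unitStrip.inter (convex_halfSpace_le (LinearMap.isLinear _) 1)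

theorem upperStrip_subset : upperStrip ⊆ unitStrip := fun _ h => h.1

theorem lowerStrip_subset : lowerStrip ⊆ unitStrip := fun _ h => h.1

theorem nonempty_interior_upperStrip : (interior upperStrip).Nonempty := by
  refine ⟨(1 / 2, 3), mem_interior.2 ⟨Set.Ioo 0 1 ×ˢ Set.Ioi 2, ?_, isOpen_Ioo.prod isOpen_Ioi,
    by constructor <;> norm_num⟩⟩
  rintro p ⟨⟨h₀, h₁⟩, h₂⟩
  have h₂' : 2 < p.2 := h₂
  exact ⟨⟨h₀.le, h₁.le⟩, by linarith⟩

theorem nonempty_interior_lowerStrip : (interior lowerStrip).Nonempty := by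
  refine ⟨(1 / 2, 0), mem_interior.2 ⟨Set.Ioo 0 1 ×ˢ Set.Iio 1, ?_, isOpen_Ioo.prod isOpen_Iio,
    by constructor <;> norm_num⟩⟩
  rintro p ⟨⟨h₀, h₁⟩, h₂⟩
  have h₂' : p.2 < 1 := h₂
  exact ⟨⟨h₀.le, h₁.le⟩, by linarith⟩

variable {E : Type*} [NormedAddCommGroup E] [NormedSpace ℝ E] (f : E →L[ℝ] ℝ × ℝ)

theorem translates_mono (i : ZMod 4) {A B : Set (ℝ × ℝ)} (h : A ⊆ B) :
    translates f i A ⊆ translates f i B := fun _ ⟨k, hk, hx⟩ => ⟨k, hk, h hx⟩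

theorem mem_translates_unitStrip {i : ZMod 4} {x : E} : x ∈ translates f i unitStrip ↔
    ∃ k : ℤ, (k : ZMod 4) = i ∧ (k : ℝ) ≤ (f x).1 ∧ (f x).1 ≤ k + 1 := by
  simp [translates, unitStrip, add_comm]

theorem mem_translates_upperStrip {i : ZMod 4} {x : E} : x ∈ translates f i upperStrip ↔
    ∃ k : ℤ, (k : ZMod 4) = i ∧ ((k : ℝ) ≤ (f x).1 ∧ (f x).1 ≤ k + 1) ∧
      1 + ((f x).1 - k) ≤ (f x).2 := by
  simp [translates, upperStrip, add_comm]

theorem mem_translates_lowerStrip {i : ZMod 4} {x : E} : x ∈ translates f i lowerStrip ↔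
    ∃ k : ℤ, (k : ZMod 4) = i ∧ ((k : ℝ) ≤ (f x).1 ∧ (f x).1 ≤ k + 1) ∧
      (f x).2 ≤ 1 + ((f x).1 - k) := by
  simp [translates, lowerStrip, add_comm]

/-- Every contact between strips is read off from this trichotomy. -/
theorem eq_or_eq_add_one {y : ℝ} {k l : ℤ} (hk : (k : ℝ) ≤ y) (hk' : y ≤ k + 1)
    (hl : (l : ℝ) ≤ y) (hl' : y ≤ l + 1) :
    l = k ∨ (l = k + 1 ∧ y = k + 1) ∨ (k = l + 1 ∧ y = k) := by
  have h₁ : l ≤ k + 1 := by exact_mod_cast hl.trans hk'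
  have h₂ : k ≤ l + 1 := by exact_mod_cast hk.trans hl'
  rcases (by omega : l = k ∨ l = k + 1 ∨ k = l + 1) with h | h | h
  · exact Or.inl h
  · subst h
    push_cast at hl
    exact Or.inr (Or.inl ⟨rfl, le_antisymm hk' hl⟩)
  · subst h
    push_cast at hk ⊢
    exact Or.inr (Or.inr ⟨rfl, le_antisymm hl' hk⟩)

theorem disjoint_translates_unitStrip (i : ZMod 4) :
    Disjoint (translates f i unitStrip) (translates f (i + 2) unitStrip) := by
  rw [Set.disjoint_left]
  intro x hx hx'
  obtain ⟨k, rfl, hk, hk'⟩ := (mem_translates_unitStrip f).1 hx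
  obtain ⟨l, hl2, hl, hl'⟩ := (mem_translates_unitStrip f).1 hx'
  have hne : ∀ j : ZMod 4, j ≠ j + 2 ∧ j + 1 ≠ j + 2 ∧ j + 1 + 2 ≠ j := by decide
  rcases eq_or_eq_add_one hk hk' hl hl' with h | ⟨h, -⟩ | ⟨h, -⟩
  · exact (hne k).1 (by rw [← hl2, h])
  · exact (hne k).2.1 (by rw [← hl2, h]; push_cast; rfl)
  · exact (hne l).2.2 (by conv_rhs => rw [hl2, h, Int.cast_add, Int.cast_one])

/-- Strips `k` and `k + 1` meet only over first coordinate `k + 1`. There the upper piece of the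
former starts at height 2 and the lower piece of the latter ends at height 1; the slope creates this
gap. -/
theorem disjoint_translates_upperStrip_lowerStrip (i : ZMod 4) :
    Disjoint (translates f i upperStrip) (translates f (i + 1) lowerStrip) := by
  rw [Set.disjoint_left]
  intro x hx hx'
  obtain ⟨k, rfl, ⟨hk, hk'⟩, hx⟩ := (mem_translates_upperStrip f).1 hx
  obtain ⟨l, hl1, ⟨hl, hl'⟩, hx'⟩ := (mem_translates_lowerStrip f).1 hx'
  have hne : ∀ j : ZMod 4, j ≠ j + 1 ∧ j + 1 + 1 ≠ j := by decide
  rcases eq_or_eq_add_one hk hk' hl hl' with h | ⟨h, h'⟩ | ⟨h, -⟩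
  · exact (hne k).1 (by rw [← hl1, h])
  · rw [h'] at hx hx'
    rw [h] at hx'
    push_cast at hx'
    linarith
  · exact (hne l).2 (by conv_rhs => rw [hl1, h, Int.cast_add, Int.cast_one])

/-- Common points have integer first coordinate, and an open map sends an open set into the integers
only if it is empty. -/
theorem interior_translates_inter_translates (hf : IsOpenMap f) {i j : ZMod 4} (hij : i ≠ j) :
    interior (translates f i unitStrip ∩ translates f j unitStrip) = ∅ := by
  have hsub : (fun x => (f x).1) '' interior (translates f i unitStrip ∩ translates f j unitStrip) ⊆
      Set.range ((↑) : ℤ → ℝ) := by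
    rintro _ ⟨x, hx, rfl⟩
    obtain ⟨hxi, hxj⟩ := interior_subset hx
    obtain ⟨k, rfl, hk, hk'⟩ := (mem_translates_unitStrip f).1 hxi
    obtain ⟨l, rfl, hl, hl'⟩ := (mem_translates_unitStrip f).1 hxj
    rcases eq_or_eq_add_one hk hk' hl hl' with h | ⟨-, h⟩ | ⟨-, h⟩
    · exact absurd (by rw [h]) hij
    · exact ⟨k + 1, by push_cast; exact h.symm⟩
    · exact ⟨k, h.symm⟩
  have hopen := (isOpenMap_fst.comp hf) _
    (isOpen_interior (s := translates f i unitStrip ∩ translates f j unitStrip))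
  have hempty : interior (Set.range ((↑) : ℤ → ℝ)) = ∅ :=
    interior_eq_empty_iff_dense_compl.2 ((Set.countable_range _).dense_compl ℝ)
  exact Set.image_eq_empty.1 (Set.subset_empty_iff.1 (hempty ▸ interior_maximal hsub hopen))

theorem nonempty_translates (hf : Function.Surjective f) (i : ZMod 4) {A : Set (ℝ × ℝ)}
    (hA : A.Nonempty) : (translates f i A).Nonempty := by
  obtain ⟨p, hp⟩ := hA
  obtain ⟨k, rfl⟩ := ZMod.intCast_surjective i
  obtain ⟨x, hx⟩ := hf (p + ((k : ℝ), 0))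
  exact ⟨x, k, rfl, by rwa [hx, add_sub_cancel_right]⟩

theorem exists_mem_translates_unitStrip (x : E) : ∃ i, x ∈ translates f i unitStrip :=
  ⟨((⌊(f x).1⌋ : ℤ) : ZMod 4), (mem_translates_unitStrip f).2
    ⟨⌊(f x).1⌋, rfl, Int.floor_le _, (Int.lt_floor_add_one _).le⟩⟩

/-- The `k`-th upper strip is joined to the half-plane by the `k + 1`-st strip. -/
theorem isPreconnected_translates_union (hf : Function.Surjective f) (i : ZMod 4) :
    IsPreconnected (translates f i upperStrip ∪ translates f (i + 1) unitStrip ∪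
      {x | (f x).2 ≤ 0}) := by
  have hconv : ∀ (k : ℤ) {A : Set (ℝ × ℝ)}, Convex ℝ A →
      IsPreconnected {x | f x - ((k : ℝ), 0) ∈ A} := fun k A hA => by
    have h : {x | f x - ((k : ℝ), 0) ∈ A} =
        (f : E →ₗ[ℝ] ℝ × ℝ) ⁻¹' ((fun p => p + (-(k : ℝ), (0 : ℝ))) ⁻¹' A) := by
      ext x
      simp [sub_eq_add_neg]
    rw [h]
    exact ((hA.translate_preimage_left _).linear_preimage _).isPreconnected
  set t : Set E := {x | (f x).2 ≤ 0}
  have ht : IsPreconnected t :=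
    ((convex_Iic (0 : ℝ)).linear_preimage (LinearMap.snd ℝ ℝ ℝ ∘ₗ (f : E →ₗ[ℝ] ℝ × ℝ))).isPreconnected
  have hstrip : ∀ k : ℤ, IsPreconnected ({x | f x - ((k : ℝ), 0) ∈ unitStrip} ∪ t) := by
    intro k
    obtain ⟨x, hx⟩ := hf ((k : ℝ), 0)
    refine (hconv k convex_unitStrip).union x ?_ ?_ ht
    · simp [unitStrip, hx]
    · simp [t, hx]
  have hupper : ∀ k : ℤ, IsPreconnected ({x | f x - ((k : ℝ), 0) ∈ upperStrip} ∪
      ({x | f x - (((k + 1 : ℤ) : ℝ), 0) ∈ unitStrip} ∪ t)) := by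
    intro k
    -- The lowest point at which upper strip `k` touches strip `k + 1`.
    obtain ⟨x, hx⟩ := hf ((k + 1 : ℝ), 2)
    refine (hconv k convex_upperStrip).union x ?_ (Or.inl ?_) (hstrip _)
    · simp only [upperStrip, Set.mem_ofPred_eq, hx, Prod.mk_sub_mk, Set.mem_Icc]
      norm_num
    · simp [unitStrip, hx]
  obtain ⟨x₀, hx₀⟩ := hf 0
  have hx₀t : x₀ ∈ t := by simp [t, hx₀]
  have hsub : ∀ k : ℤ, (k : ZMod 4) = i + 1 → {x | f x - ((k : ℝ), 0) ∈ unitStrip} ∪ t ⊆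
      translates f i upperStrip ∪ translates f (i + 1) unitStrip ∪ t := by
    rintro k hk x (hx | hx)
    · exact Or.inl (Or.inr ⟨k, hk, hx⟩)
    · exact Or.inr hx
  refine isPreconnected_of_forall x₀ ?_
  rintro y ((⟨k, rfl, hy⟩ | ⟨k, hk, hy⟩) | hy)
  · refine ⟨_, Set.union_subset ?_ (hsub (k + 1) (by push_cast; rfl)), Or.inr (Or.inr hx₀t),
      Or.inl hy, hupper k⟩
    exact fun x hx => Or.inl (Or.inl ⟨k, rfl, hx⟩)
  · exact ⟨_, hsub k hk, Or.inr hx₀t, Or.inl hy, hstrip k⟩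
  · exact ⟨t, Set.subset_union_right, hx₀t, hy, ht⟩

theorem satisfiableOver_top [CompleteSpace E] (hf : Function.Surjective f) :
    SatisfiableOver (⊤ : BooleanSubalgebra (RC E)) phiInfty := by
  have hfo : IsOpenMap f := f.isOpenMap hf
  let R : ZMod 4 → RC E := fun i => ⟨translates f i unitStrip, closure_interior_translates f hf i
    isClosed_unitStrip convex_unitStrip
    (nonempty_interior_upperStrip.mono (interior_mono upperStrip_subset)) fun _ h => h⟩
  let R' : ZMod 4 → RC E := fun i => ⟨translates f i upperStrip, closure_interior_translates f hf i
    isClosed_upperStrip convex_upperStrip nonempty_interior_upperStrip upperStrip_subset⟩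
  let S : ZMod 4 → RC E := fun i => ⟨translates f i lowerStrip, closure_interior_translates f hf i
    isClosed_lowerStrip convex_lowerStrip nonempty_interior_lowerStrip lowerStrip_subset⟩
  let t : RC E := ⟨{x | (f x).2 ≤ 0}, by
    have hc : Continuous fun x => (f x).2 := by fun_prop
    have ho : IsOpenMap fun x => (f x).2 := isOpenMap_snd.comp hfo
    change closure (interior ((fun x => (f x).2) ⁻¹' Set.Iic 0)) = (fun x => (f x).2) ⁻¹' Set.Iic 0
    rw [← ho.preimage_interior_eq_interior_preimage hc, interior_Iic,
      ← ho.preimage_closure_eq_closure_preimage hc, closure_Iio]⟩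
  have hne : ∀ {X : RC E}, (X : Set E).Nonempty → X ≠ ⊥ := by
    rintro _ h rfl
    exact Set.not_nonempty_empty h
  have hinf : ∀ i j, i ≠ j → R i ⊓ R j = ⊥ := fun i j hij => Subtype.ext <| by
    rw [RC.coe_inf, RC.coe_bot, interior_translates_inter_translates f hfo hij, closure_empty]
  have hRne : ∀ i, R i ≠ ⊥ := fun i => hne (nonempty_translates f hf i
    ((nonempty_interior_upperStrip.mono interior_subset).mono upperStrip_subset))
  have hR' : ∀ i, R' i ≠ ⊥ ∧ R' i ≤ R i := fun i =>
    ⟨hne (nonempty_translates f hf i (nonempty_interior_upperStrip.mono interior_subset)),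
      translates_mono f i upperStrip_subset⟩
  have hR't : ∀ i, Disjoint (R' i : Set E) t := by
    intro i
    rw [Set.disjoint_left]
    intro x hx hxt
    obtain ⟨k, -, ⟨hk, -⟩, hx⟩ := (mem_translates_upperStrip f).1 hx
    have hxt' : (f x).2 ≤ 0 := hxt
    linarith
  have hsdiff : ∀ i, R i \ R' i ≤ S i := by
    intro i
    rw [sdiff_le_iff]
    rintro x ⟨k, hk, hx⟩
    rcases le_total (1 + (f x - ((k : ℝ), 0)).1) (f x - ((k : ℝ), 0)).2 with h | h
    · exact Or.inl ⟨k, hk, hx, h⟩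
    · exact Or.inr ⟨k, hk, hx, h⟩
  have hshield : ∀ i, Disjoint (R' i : Set E) (R (i + 1) \ R' (i + 1) : RC E) := fun i =>
    (disjoint_translates_upperStrip_lowerStrip f i).mono_right (hsdiff (i + 1))
  have hsum : R 0 ⊔ (R 1 ⊔ (R 2 ⊔ R 3)) = ⊤ := by
    refine Subtype.ext (Set.eq_univ_of_forall fun x => ?_)
    obtain ⟨i, hi⟩ := exists_mem_translates_unitStrip f x
    fin_cases i
    exacts [Or.inl hi, Or.inr (Or.inl hi), Or.inr (Or.inr (Or.inl hi)),
      Or.inr (Or.inr (Or.inr hi))]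
  -- The cast to `ZMod 4` turns 4 to 7 back into the labels 0 to 3.
  refine ⟨fun v => if v < 4 then R v else if v < 8 then R' v else t, fun v => trivial, ?_⟩
  exact phiInfty_holds_iff.2 ⟨hsum,
    ⟨hinf 0 1 (by decide), hinf 0 2 (by decide), hinf 0 3 (by decide), hinf 1 2 (by decide),
      hinf 1 3 (by decide), hinf 2 3 (by decide)⟩,
    forall_zmod_four.1 hRne,
    ⟨disjoint_translates_unitStrip f 0, disjoint_translates_unitStrip f 1⟩,
    forall_zmod_four.1 hR',
    hne (hf 0 |>.imp fun x hx => by simp [t, hx]),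
    forall_zmod_four.1 (isPreconnected_translates_union f hf),
    forall_zmod_four.1 hR't,
    forall_zmod_four.1 hshield⟩

end Strips

theorem exists_surjective_prod {n : ℕ} (hn : 2 ≤ n) :
    ∃ f : EuclideanSpace ℝ (Fin n) →L[ℝ] ℝ × ℝ, Function.Surjective f := by
  refine ⟨(EuclideanSpace.proj ⟨0, by omega⟩).prod (EuclideanSpace.proj ⟨1, by omega⟩), ?_⟩
  rintro ⟨a, b⟩
  refine ⟨WithLp.toLp 2 fun j => if j.val = 0 then a else b, ?_⟩
  simp

end BCc

theorem mainTheorem8 :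
    (∀ n : ℕ, 2 ≤ n →
      BCc.SatisfiableOver (⊤ : BooleanSubalgebra (BCc.RC (EuclideanSpace ℝ (Fin n))))
        BCc.phiInfty) ∧
    (∀ (T : Type*) [TopologicalSpace T] [LocallyConnectedSpace T], BCc.Unicoherent T →
      ∀ I : ℕ → BCc.RC T, BCc.phiInfty.Holds I →
        ∃ v ∈ BCc.phiInfty.vars, (BCc.components (I v : Set T)).Infinite) ∧
    (∀ n : ℕ, 1 ≤ n → ¬ BCc.SatisfiableOver (BCc.RCP n) BCc.phiInfty) := by
  refine ⟨fun n hn => ?_, fun T _ _ hT I hI => BCc.exists_components_infinite_of_holds hT hI, ?_⟩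
  · obtain ⟨f, hf⟩ := BCc.exists_surjective_prod hn
    exact BCc.satisfiableOver_top f hf
  · rintro n - ⟨I, hI, hholds⟩
    obtain ⟨v, -, hv⟩ :=
      BCc.exists_components_infinite_of_holds (BCc.unicoherent_euclideanSpace n) hholds
    exact hv (BCc.isFiniteConvexSum_of_mem_RCP (hI v)).1.components_finite
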